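/- For a number field $F$ write $(\ast)$ for the condition: there is no algebraic integer $z\in\mathcal O_F$ which is not totally real (i.e. whose image under some complex embedding of $F$ is not real) and satisfies $|\varphi(z)|\le 3$ for every embedding $\varphi:F\to\mathbb C$. **Setting.** Let $K=\mathbb Q(\sqrt D)$ be a real quadratic field of discriminant $D>0$ and let $F/K$ be a CM extension, i.e. $F$ is a totally complex quadratic extension of $K$. Let $D_2$ be the norm of the relative discriminant of $F/K$. Let $\sigma_1,\bar\sigma_1,\sigma_2,\bar\sigma_2$ be the complex embeddings of $F$, and let $J=J^H\in M_3(F)$ be a Hermitian matrix (with respect to complex conjugation on $F$) such that the form $\langle z,w\rangle=w^HJ^{\sigma_1}z$ on $\mathbb C^3$ has signature $(2,1)$ and $J^{\sigma_2}, J^{\bar\sigma_2}$ are (positive or negative) definite. Let $\mathbb B^2$ be the set of negative lines of $(\mathbb C^3,J^{\sigma_1})$, with the Bergman distance $d$ given by $$\cosh^2\!\left(\frac{d(u,v)}2\right)=\frac{\langle u,v\rangle\langle v,u\rangle}{\langle u,u\rangle\langle v,v\rangle},$$ and let $\Gamma=SU(J^{\sigma_1})\cap SL_3(\mathcal O_F)$,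 where $F$ is identified with $\sigma_1(F)$, acting on $\mathbb B^2$. A point $u\in\mathbb B^2$ is an *isolated elliptic point* of $\Gamma$ if some elliptic $M\in\Gamma$ (one having a fixed point in $\mathbb B^2$) fixes $u$ and $u$ is an isolated point of the set of points of $\mathbb B^2$ fixed by $M$. **Proposition.** 1. There is an absolute constant $D_0'>0$ such that, for every CM extension $F/K$ of a real quadratic field $K$, $D_2>D_0'$ implies that $F$ satisfies $(\ast)$. 2. For every $R>0$ there exists $D_0(R)>0$, depending only on $R$, such that for all $K$, $F$, $\sigma_1$, $J$ as in the setting with $F$ satisfying $(\ast)$ (in particular whenever $D_2>D_0'$): if $D>D_0(R)$, then any two distinct isolated elliptic points $u\ne v$ of $\Gamma$ in $\mathbb B^2$ satisfy $d(u,v)>R$. -/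

import Mathlib

open NumberField
open scoped Matrix LinearAlgebra.Projectivization

universe u v

namespace BallQuotient

/-! ### The projective model of the complex hyperbolic plane -/

/-- The Hermitian form `⟨z, w⟩ = wᴴ J z` on `ℂ³`. -/
noncomputable def hform (J : Matrix (Fin 3) (Fin 3) ℂ) (z w : Fin 3 → ℂ) : ℂ :=
  star w ⬝ᵥ (J *ᵥ z)

/-- A complex `3 × 3` matrix is Hermitian of signature `(2, 1)`: it is congruent to
`diag(1, 1, -1)`. -/
def HasSignatureTwoOne (J : Matrix (Fin 3) (Fin 3) ℂ) : Prop :=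
  ∃ T : Matrix (Fin 3) (Fin 3) ℂ, IsUnit T.det ∧ J = Tᴴ * Matrix.diagonal ![1, 1, -1] * T

/-- The complex hyperbolic plane `𝔹²`: the negative lines of `(ℂ³, J)`. -/
def ball (J : Matrix (Fin 3) (Fin 3) ℂ) : Set (ℙ ℂ (Fin 3 → ℂ)) :=
  {p | (hform J p.rep p.rep).re < 0}

/-- The tance `⟨u, v⟩⟨v, u⟩ / (⟨u, u⟩⟨v, v⟩)`, a real number for a Hermitian matrix `J`. -/
noncomputable def tance (J : Matrix (Fin 3) (Fin 3) ℂ) (p q : ℙ ℂ (Fin 3 → ℂ)) : ℝ :=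
  (hform J p.rep q.rep * hform J q.rep p.rep /
    (hform J p.rep p.rep * hform J q.rep q.rep)).re

/-- The distance of the Bergman metric with holomorphic sectional curvature `-1`, given on
`𝔹²` by `cosh² (d(u, v) / 2) = ta(u, v)`. -/
noncomputable def bergmanDist (J : Matrix (Fin 3) (Fin 3) ℂ) (p q : ℙ ℂ (Fin 3 → ℂ)) : ℝ :=
  2 * Real.arcosh (√(tance J p q))

theorem hform_smul_smul (J : Matrix (Fin 3) (Fin 3) ℂ) (a b : ℂ) (z w : Fin 3 → ℂ) :
    hform J (a • z) (b • w) = a * star b * hform J z w := by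
  simp only [hform, Matrix.mulVec_smul, star_smul, smul_dotProduct, dotProduct_smul, smul_eq_mul]
  ring

/-- Membership in the ball may be tested on any representative. -/
theorem mk_mem_ball_iff (J : Matrix (Fin 3) (Fin 3) ℂ) (z : Fin 3 → ℂ) (hz : z ≠ 0) :
    Projectivization.mk ℂ z hz ∈ ball J ↔ (hform J z z).re < 0 := by
  obtain ⟨a, ha⟩ := Projectivization.exists_smul_eq_mk_rep ℂ z hz
  have h : (hform J (Projectivization.mk ℂ z hz).rep (Projectivization.mk ℂ z hz).rep).re
      = Complex.normSq (a : ℂ) * (hform J z z).re := by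
    rw [← ha, Units.smul_def, hform_smul_smul, show star (a : ℂ) = (starRingEnd ℂ) a from rfl,
      Complex.mul_conj, Complex.re_ofReal_mul]
  have ha' : 0 < Complex.normSq (a : ℂ) := Complex.normSq_pos.2 a.ne_zero
  change (hform J _ _).re < 0 ↔ _
  rw [h]
  constructor
  · intro h'
    by_contra hc
    exact absurd h' (not_lt.2 (mul_nonneg ha'.le (not_lt.1 hc)))
  · exact mul_neg_of_pos_of_neg ha'

/-- The tance may be computed on any representatives. -/
theorem tance_mk (J : Matrix (Fin 3) (Fin 3) ℂ) (z w : Fin 3 → ℂ) (hz : z ≠ 0) (hw : w ≠ 0) :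
    tance J (Projectivization.mk ℂ z hz) (Projectivization.mk ℂ w hw) =
      (hform J z w * hform J w z / (hform J z z * hform J w w)).re := by
  obtain ⟨a, ha⟩ := Projectivization.exists_smul_eq_mk_rep ℂ z hz
  obtain ⟨b, hb⟩ := Projectivization.exists_smul_eq_mk_rep ℂ w hw
  have ha0 : (a : ℂ) ≠ 0 := a.ne_zero
  have hb0 : (b : ℂ) ≠ 0 := b.ne_zero
  have ha1 : star (a : ℂ) ≠ 0 := star_ne_zero.2 ha0
  have hb1 : star (b : ℂ) ≠ 0 := star_ne_zero.2 hb0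
  unfold tance
  rw [← ha, ← hb]
  simp only [Units.smul_def, hform_smul_smul]
  congr 1
  have hc : (a : ℂ) * star (a : ℂ) * ((b : ℂ) * star (b : ℂ)) ≠ 0 :=
    mul_ne_zero (mul_ne_zero ha0 ha1) (mul_ne_zero hb0 hb1)
  rw [← mul_div_mul_left (hform J z w * hform J w z) (hform J z z * hform J w w) hc]
  congr 1 <;> ring

/-- The defining relation of the Bergman distance. -/
theorem cosh_sq_bergmanDist (J : Matrix (Fin 3) (Fin 3) ℂ) (p q : ℙ ℂ (Fin 3 → ℂ))
    (h : 1 ≤ tance J p q) : Real.cosh (bergmanDist J p q / 2) ^ 2 = tance J p q := by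
  have h1 : 1 ≤ √(tance J p q) := Real.one_le_sqrt.2 h
  rw [bergmanDist, mul_div_cancel_left₀ _ two_ne_zero, Real.cosh_arcosh h1,
    Real.sq_sqrt (zero_le_one.trans h)]

/-! ### Special unitary groups and isolated elliptic points -/

/-- The special unitary group `SU(J)` as a subgroup of `SL₃(ℂ)`. -/
def specialUnitary (J : Matrix (Fin 3) (Fin 3) ℂ) :
    Subgroup (Matrix.SpecialLinearGroup (Fin 3) ℂ) where
  carrier := {M | (M : Matrix (Fin 3) (Fin 3) ℂ)ᴴ * J * (M : Matrix (Fin 3) (Fin 3) ℂ) = J}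
  one_mem' := by simp
  mul_mem' := by
    intro A B hA hB
    simp only [Set.mem_ofPred_eq, Matrix.SpecialLinearGroup.coe_mul,
      Matrix.conjTranspose_mul] at hA hB ⊢
    rw [show (B : Matrix (Fin 3) (Fin 3) ℂ)ᴴ * (A : Matrix (Fin 3) (Fin 3) ℂ)ᴴ * J *
        ((A : Matrix (Fin 3) (Fin 3) ℂ) * (B : Matrix (Fin 3) (Fin 3) ℂ)) =
        (B : Matrix (Fin 3) (Fin 3) ℂ)ᴴ * ((A : Matrix (Fin 3) (Fin 3) ℂ)ᴴ * J *
        (A : Matrix (Fin 3) (Fin 3) ℂ)) * (B : Matrix (Fin 3) (Fin 3) ℂ) by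
        simp only [Matrix.mul_assoc], hA, hB]
  inv_mem' := by
    intro A hA
    have h1 : (A : Matrix (Fin 3) (Fin 3) ℂ) *
        ((A⁻¹ : Matrix.SpecialLinearGroup (Fin 3) ℂ) : Matrix (Fin 3) (Fin 3) ℂ) = 1 := by
      rw [← Matrix.SpecialLinearGroup.coe_mul, mul_inv_cancel,
        Matrix.SpecialLinearGroup.coe_one]
    simp only [Set.mem_ofPred_eq] at hA ⊢
    generalize ((A⁻¹ : Matrix.SpecialLinearGroup (Fin 3) ℂ) : Matrix (Fin 3) (Fin 3) ℂ) = B at *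
    generalize (A : Matrix (Fin 3) (Fin 3) ℂ) = C at *
    have h2 : Bᴴ * Cᴴ = 1 := by rw [← Matrix.conjTranspose_mul, h1, Matrix.conjTranspose_one]
    calc Bᴴ * J * B = Bᴴ * (Cᴴ * J * C) * B := by rw [hA]
      _ = (Bᴴ * Cᴴ) * J * (C * B) := by simp only [Matrix.mul_assoc]
      _ = J := by rw [h1, h2, one_mul, mul_one]

/-- The points of the ball fixed by `M`. -/
def fixedLocus (J : Matrix (Fin 3) (Fin 3) ℂ) (M : Matrix.SpecialLinearGroup (Fin 3) ℂ) :
    Set (ℙ ℂ (Fin 3 → ℂ)) :=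
  {p | p ∈ ball J ∧ M • p = p}

/-- An isometry is elliptic if it fixes at least one point of the ball. -/
def IsElliptic (J : Matrix (Fin 3) (Fin 3) ℂ) (M : Matrix.SpecialLinearGroup (Fin 3) ℂ) : Prop :=
  (fixedLocus J M).Nonempty

/-- `p` is an isolated elliptic point of `Γ`: some elliptic element `M` of `Γ` fixes `p`, and
`p` is an isolated point of the locus fixed by `M`. -/
def IsIsolatedEllipticPoint (J : Matrix (Fin 3) (Fin 3) ℂ)
    (Γ : Subgroup (Matrix.SpecialLinearGroup (Fin 3) ℂ)) (p : ℙ ℂ (Fin 3 → ℂ)) : Prop :=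
  ∃ M ∈ Γ, IsElliptic J M ∧ p ∈ fixedLocus J M ∧
    ∃ ε : ℝ, 0 < ε ∧ ∀ q ∈ fixedLocus J M, bergmanDist J p q < ε → q = p

/-! ### The arithmetic data -/

section Arithmetic

variable (K : Type u) (F : Type v) [Field K] [NumberField K] [Field F] [NumberField F]

/-- The relative discriminant ideal of `F / K`: the ideal of `𝓞 K` generated by the
discriminants of the `K`-bases of `F` that consist of algebraic integers. -/
def relDiscr [Algebra K F] : Ideal (𝓞 K) :=
  Ideal.span {d : 𝓞 K | ∃ b : Module.Basis (Fin (Module.finrank K F)) K F,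
    (∀ i, IsIntegral ℤ (b i)) ∧ (d : K) = Algebra.discr K b}

/-- There is no algebraic integer `z` of `F` that is not totally real and has `|z| ≤ 3` in all
complex embeddings. -/
def NoSmallNonrealInteger : Prop :=
  ∀ z : 𝓞 F, (∀ φ : F →+* ℂ, ‖φ (z : F)‖ ≤ 3) → ∀ φ : F →+* ℂ, (φ (z : F)).im = 0

variable {F}

/-- For a CM field `F`: the matrix `J` over `F` is Hermitian (with respect to the complex
conjugation of `F`), of signature `(2, 1)` under the pair of embeddings `σ₁, σ̄₁`, and (positive
or negative) definite under all the other embeddings. -/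
structure IsAdmissibleForm [IsCMField F] (σ₁ : F →+* ℂ) (J : Matrix (Fin 3) (Fin 3) F) :
    Prop where
  isHermitian : ∀ i j, IsCMField.complexConj F (J j i) = J i j
  signature : HasSignatureTwoOne (J.map σ₁)
  definite : ∀ σ : F →+* ℂ, σ ≠ σ₁ → σ ≠ ComplexEmbedding.conjugate σ₁ →
    (∀ z : Fin 3 → ℂ, z ≠ 0 → 0 < (hform (J.map σ) z z).re) ∨
    (∀ z : Fin 3 → ℂ, z ≠ 0 → (hform (J.map σ) z z).re < 0)

/-- The lattice `SU(J^σ₁, 𝓞 F) = SU(J^σ₁) ∩ SL₃(𝓞 F)`, where `F` is identified with its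
image under `σ₁`. -/
def arithmeticLattice (σ₁ : F →+* ℂ) (J : Matrix (Fin 3) (Fin 3) F) :
    Subgroup (Matrix.SpecialLinearGroup (Fin 3) ℂ) :=
  specialUnitary (J.map σ₁) ⊓
    (Matrix.SpecialLinearGroup.map (n := Fin 3) (σ₁.comp (algebraMap (𝓞 F) F))).range

end Arithmetic

end BallQuotient

namespace BallQuotient

section Proof

open Matrix Polynomial
open scoped ComplexOrder

/-! ### Hermitian form, and the definite form attached to a negative line. -/

section Hform

variable {J : Matrix (Fin 3) (Fin 3) ℂ}

/-! Part 1: if `z` is a small integer that is not totally real, then `1, z` is an integral basis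
vector pair of `F / K` whose discriminant is the square of a difference of conjugates, hence at most
36 at each of the two real places. Its norm is at most 36² and is a multiple of the norm of the
relative discriminant (`absNorm_relDiscr_le`).

Part 2: an isolated elliptic point `u` is fixed by a lattice element `m` whose eigenvalue on `u`
does not recur on the orthogonal complement, so the projection to `u` is a polynomial in `m`
(`exists_aeval_eq_proj`). Likewise for `v` and `n`. Suppose `d(u, v) ≤ R` and consider traces of
products of powers of `m`, `n` and their inverses. At `σ₁` they are bounded in terms of `R`, since
each factor preserves a definite form obtained by flipping `J` at its fixed point
(`norm_trace_mul_le_of_fix`). At the other place the group is compact and they are at most 3. For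
large `D`, condition (∗) then forces each trace to have the same value in all embeddings
(`NoSmallNonrealInteger.embedding_eq`).

So the Gram matrix of the powers for the form `tr (Z Z^*)` is the same at `σ₁` and at a definite
embedding, where it is positive semidefinite. With the complex coefficients that express the
difference of the projections to `u` and `v`, it takes the value `2 - 2 ta(u, v)` at `σ₁`, which is
negative for `u ≠ v` (`normSq_hform_le_one_of_trace_eq`). -/

theorem hform_add_left (J : Matrix (Fin 3) (Fin 3) ℂ) (z z' w : Fin 3 → ℂ) :
    hform J (z + z') w = hform J z w + hform J z' w := by
  simp [hform, mulVec_add, dotProduct_add]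

theorem hform_add_right (J : Matrix (Fin 3) (Fin 3) ℂ) (z w w' : Fin 3 → ℂ) :
    hform J z (w + w') = hform J z w + hform J z w' := by
  simp [hform, add_dotProduct]

theorem hform_smul_left (J : Matrix (Fin 3) (Fin 3) ℂ) (a : ℂ) (z w : Fin 3 → ℂ) :
    hform J (a • z) w = a * hform J z w := by
  simp [hform, mulVec_smul, dotProduct_smul]

theorem hform_smul_right (J : Matrix (Fin 3) (Fin 3) ℂ) (a : ℂ) (z w : Fin 3 → ℂ) :
    hform J z (a • w) = star a * hform J z w := by
  simp [hform, smul_dotProduct]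

theorem star_hform (hJ : J.IsHermitian) (z w : Fin 3 → ℂ) :
    star (hform J z w) = hform J w z := by
  rw [hform, star_dotProduct, star_mulVec, hJ.eq, star_star, hform, dotProduct_mulVec,
    dotProduct_comm]

theorem hform_self_eq_re (hJ : J.IsHermitian) (z : Fin 3 → ℂ) :
    hform J z z = ((hform J z z).re : ℂ) :=
  (Complex.conj_eq_iff_re.1 (star_hform hJ z z)).symm

theorem hform_mulVec_mulVec {M : Matrix (Fin 3) (Fin 3) ℂ} (hM : Mᴴ * J * M = J)
    (z w : Fin 3 → ℂ) : hform J (M *ᵥ z) (M *ᵥ w) = hform J z w := by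
  rw [hform, hform, star_mulVec, ← dotProduct_mulVec, mulVec_mulVec, mulVec_mulVec, hM]

theorem HasSignatureTwoOne.isHermitian (h : HasSignatureTwoOne J) : J.IsHermitian := by
  obtain ⟨T, -, rfl⟩ := h
  refine isHermitian_conjTranspose_mul_mul T ?_
  refine isHermitian_diagonal_of_self_adjoint _ ?_
  ext i
  fin_cases i <;> simp

theorem HasSignatureTwoOne.isUnit_det (h : HasSignatureTwoOne J) : IsUnit J.det := by
  obtain ⟨T, hT, rfl⟩ := h
  rw [det_mul, det_mul, det_conjTranspose, det_diagonal]
  refine (IsUnit.mul hT.star ?_).mul hT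
  simp [Fin.prod_univ_three]

/-- The orthogonal complement of a negative vector is positive. -/
theorem HasSignatureTwoOne.hform_pos (h : HasSignatureTwoOne J) {u w : Fin 3 → ℂ}
    (hu : (hform J u u).re < 0) (huw : hform J w u = 0) (hw : w ≠ 0) :
    0 < (hform J w w).re := by
  obtain ⟨T, hT, rfl⟩ := h
  have key (z w : Fin 3 → ℂ) : hform (Tᴴ * diagonal ![1, 1, -1] * T) z w =
      (T *ᵥ z) 0 * star ((T *ᵥ w) 0) + (T *ᵥ z) 1 * star ((T *ᵥ w) 1)
        - (T *ᵥ z) 2 * star ((T *ᵥ w) 2) := by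
    rw [hform, ← mulVec_mulVec, ← mulVec_mulVec, dotProduct_mulVec, ← star_mulVec]
    simp only [dotProduct, Fin.sum_univ_three, mulVec_diagonal, Pi.star_apply]
    simp
    ring
  have hw' : T *ᵥ w ≠ 0 := fun h0 => hw (by
    have := congrArg (T⁻¹ *ᵥ ·) h0
    simpa [mulVec_mulVec, nonsing_inv_mul _ hT] using this)
  have hns (a b c : ℂ) : (a * star a + b * star b - c * star c).re =
      Complex.normSq a + Complex.normSq b - Complex.normSq c := by
    simp [Complex.normSq_apply]
  rw [key] at hu huw ⊢
  rw [hns] at hu ⊢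
  generalize T *ᵥ u = x at *
  generalize hy : T *ᵥ w = y at *
  have h1 : y 2 * star (x 2) = y 0 * star (x 0) + y 1 * star (x 1) := by
    linear_combination -huw
  -- Cauchy–Schwarz in ℂ², applied to the orthogonality relation; `h4` below is the defect in
  -- Lagrange's identity.
  have h2 : Complex.normSq (y 2) * Complex.normSq (x 2) ≤
      (Complex.normSq (y 0) + Complex.normSq (y 1)) *
        (Complex.normSq (x 0) + Complex.normSq (x 1)) := by
    have h3 : Complex.normSq (y 2) * Complex.normSq (x 2) =
        Complex.normSq (y 0 * star (x 0) + y 1 * star (x 1)) := by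
      rw [← h1, Complex.normSq_mul]
      congr 1
      exact (Complex.normSq_conj _).symm
    have h4 := Complex.normSq_nonneg (y 0 * x 1 - y 1 * x 0)
    rw [h3]
    simp only [Complex.normSq_apply, Complex.add_re, Complex.add_im, Complex.mul_re,
      Complex.mul_im, Complex.sub_re, Complex.sub_im, RCLike.star_def, Complex.conj_re,
      Complex.conj_im] at h4 ⊢
    nlinarith [h4]
  by_contra! hc
  have n0 := Complex.normSq_nonneg (y 0)
  have n1 := Complex.normSq_nonneg (y 1)
  have n2 := Complex.normSq_nonneg (y 2)
  have m0 := Complex.normSq_nonneg (x 0)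
  have m1 := Complex.normSq_nonneg (x 1)
  have hy2 : Complex.normSq (y 2) = 0 := by
    by_contra hne
    have : 0 < Complex.normSq (y 2) := lt_of_le_of_ne n2 (Ne.symm hne)
    nlinarith
  have hy0 : Complex.normSq (y 0) = 0 := by linarith
  have hy1 : Complex.normSq (y 1) = 0 := by linarith
  refine hw' ?_
  ext i
  fin_cases i
  · simpa using hy0
  · simpa using hy1
  · simpa using hy2

/-- The sign is plus because `⟨u, u⟩ = -1`. -/
theorem hform_sub_orthogonal {u : Fin 3 → ℂ} (hu : hform J u u = -1)
    (z : Fin 3 → ℂ) : hform J (z + hform J z u • u) u = 0 := by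
  rw [hform_add_left, hform_smul_left, hu]
  ring

theorem hform_self_eq (hJ : J.IsHermitian) {u : Fin 3 → ℂ} (hu : hform J u u = -1)
    (z : Fin 3 → ℂ) : hform J z z =
      hform J (z + hform J z u • u) (z + hform J z u • u) - hform J z u * star (hform J z u) := by
  rw [hform_add_right, hform_smul_right, hform_sub_orthogonal hu, hform_add_left, hform_smul_left,
    star_hform hJ]
  ring

/-- The definite form obtained by switching the sign of `J` on the negative line of `u`. -/
noncomputable def flip (J : Matrix (Fin 3) (Fin 3) ℂ) (u : Fin 3 → ℂ) : Matrix (Fin 3) (Fin 3) ℂ :=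
  J + (2 : ℂ) • vecMulVec (J *ᵥ u) (star u ᵥ* J)

theorem star_vecMul_eq (hJ : J.IsHermitian) (u : Fin 3 → ℂ) :
    star u ᵥ* J = star (J *ᵥ u) := by
  rw [star_mulVec, hJ.eq]

theorem hform_flip (u z w : Fin 3 → ℂ) :
    hform (flip J u) z w = hform J z w + 2 * (hform J z u * hform J u w) := by
  simp only [hform, flip, add_mulVec, smul_mulVec, vecMulVec_mulVec, dotProduct_add,
    dotProduct_smul, smul_eq_mul, ← dotProduct_mulVec, op_smul_eq_smul]

/-- Splitting `z` along `u` and its orthogonal complement, the flipped form adds `|⟨z, u⟩|²` where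
`J` subtracts it, and the complement is already positive. -/
theorem posDef_flip (h : HasSignatureTwoOne J) {u : Fin 3 → ℂ} (hu : hform J u u = -1) :
    (flip J u).PosDef := by
  have hJ := h.isHermitian
  have hH : (flip J u).IsHermitian := by
    refine hJ.add ?_
    rw [star_vecMul_eq hJ, IsHermitian, conjTranspose_smul, conjTranspose_vecMulVec, star_star]
    simp
  rw [posDef_iff_dotProduct_mulVec]
  refine ⟨hH, fun z hz => ?_⟩
  change 0 < hform (flip J u) z z
  have e : hform (flip J u) z z = (((hform J (z + hform J z u • u) (z + hform J z u • u)).re +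
      Complex.normSq (hform J z u) : ℝ) : ℂ) := by
    rw [hform_flip, hform_self_eq hJ hu z, ← star_hform hJ z u, Complex.ofReal_add,
      ← hform_self_eq_re hJ, ← Complex.mul_conj]
    simp only [RCLike.star_def]
    ring
  rw [e, Complex.zero_lt_real]
  by_cases h0 : z + hform J z u • u = 0
  · rw [h0]
    have : hform J z u ≠ 0 := by
      intro h1
      rw [h1] at h0
      simp at h0
      exact hz h0
    have := Complex.normSq_pos.2 this
    simpa [hform] using this
  · exact add_pos_of_pos_of_nonneg
      (h.hform_pos (by rw [hu]; simp) (hform_sub_orthogonal hu z) h0) (Complex.normSq_nonneg _)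

/-- The flip is `J` times the reflection `1 + 2 v vᴴ J`, an involution because `⟨v, v⟩ = -1`. -/
theorem inv_flip (h : HasSignatureTwoOne J) {v : Fin 3 → ℂ} (hv : hform J v v = -1) :
    (flip J v)⁻¹ = J⁻¹ + (2 : ℂ) • vecMulVec v (star v) := by
  have hv' : star v ᵥ* J ⬝ᵥ v = -1 := by rw [← dotProduct_mulVec]; exact hv
  refine inv_eq_left_inv ?_
  rw [flip, add_mul, mul_add, mul_add, nonsing_inv_mul _ h.isUnit_det]
  simp only [Matrix.mul_smul, Matrix.smul_mul, mul_vecMulVec, vecMulVec_mul, mulVec_mulVec,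
    nonsing_inv_mul _ h.isUnit_det, one_mulVec]
  rw [smul_mulVec, vecMulVec_mulVec, hv']
  ext i j
  simp [vecMulVec_apply]
  ring

/-- The constant is `3 - 2 - 2`: the identity, and one rank-one term for each of `u` and `v`. -/
theorem trace_inv_flip_mul_flip (h : HasSignatureTwoOne J) {u v : Fin 3 → ℂ}
    (hu : hform J u u = -1) (hv : hform J v v = -1) :
    ((flip J v)⁻¹ * flip J u).trace = 4 * (hform J u v * hform J v u) - 1 := by
  have hv' : v ⬝ᵥ star v ᵥ* J = -1 := by
    rw [dotProduct_comm, ← dotProduct_mulVec]; exact hv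
  have hu' : u ⬝ᵥ star u ᵥ* J = -1 := by
    rw [dotProduct_comm, ← dotProduct_mulVec]; exact hu
  have huv : v ⬝ᵥ star u ᵥ* J = hform J v u := by
    rw [dotProduct_comm, ← dotProduct_mulVec]; rfl
  have huv' : star v ᵥ* J ⬝ᵥ u = hform J u v := by
    rw [← dotProduct_mulVec]; rfl
  rw [inv_flip h hv, flip, add_mul, mul_add, mul_add, nonsing_inv_mul _ h.isUnit_det]
  simp only [Matrix.mul_smul, Matrix.smul_mul, mul_vecMulVec, vecMulVec_mul, mulVec_mulVec,
    nonsing_inv_mul _ h.isUnit_det, one_mulVec]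
  rw [smul_mulVec, vecMulVec_mulVec, huv']
  simp only [trace_add, trace_smul, trace_vecMulVec, smul_dotProduct, hv', hu', huv, trace_one,
    op_smul_eq_smul, smul_eq_mul, Fintype.card_fin]
  push_cast
  ring

/-- The eigenvalue `α` is unimodular because `⟨u, u⟩ ≠ 0`, so it cancels in the rank-one term. -/
theorem flip_isometry (hJ : J.IsHermitian) {A : Matrix (Fin 3) (Fin 3) ℂ} (hA : Aᴴ * J * A = J)
    {u : Fin 3 → ℂ} (hu : hform J u u = -1) {α : ℂ} (hAu : A *ᵥ u = α • u) :
    Aᴴ * flip J u * A = flip J u := by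
  have hα : α * star α = 1 := by
    have := hform_mulVec_mulVec hA u u
    rw [hAu, hform_smul_smul, hu] at this
    linear_combination -this
  have h1 : Aᴴ *ᵥ (J *ᵥ u) = star α • (J *ᵥ u) := by
    have h2 : u = star α • (A *ᵥ u) := by
      rw [hAu, smul_smul, mul_comm, hα, one_smul]
    conv_lhs => rw [h2]
    rw [mulVec_smul, mulVec_smul, mulVec_mulVec, mulVec_mulVec, hA]
  have h3 : (star u ᵥ* J) ᵥ* A = α • (star u ᵥ* J) := by
    have := congrArg star h1
    rw [star_mulVec, star_smul, star_star, conjTranspose_conjTranspose] at this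
    rwa [star_vecMul_eq hJ]
  rw [flip, mul_add, add_mul, hA, Matrix.mul_smul, Matrix.smul_mul, mul_vecMulVec, vecMulVec_mul, h1, h3]
  congr 2
  ext i j
  simp only [vecMulVec_apply, Pi.smul_apply, smul_eq_mul]
  linear_combination (J *ᵥ u) i * (star u ᵥ* J) j * hα

end Hform

/-! ### Trace inequalities for definite forms. -/

section Traces

variable {n : Type*} [Fintype n] [DecidableEq n]

open scoped MatrixOrder in
theorem trace_mul_nonneg_of_posSemidef {A B : Matrix n n ℂ} (hA : A.PosSemidef)
    (hB : B.PosSemidef) : 0 ≤ (A * B).trace := by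
  obtain ⟨S, rfl⟩ := CStarAlgebra.nonneg_iff_eq_star_mul_self.1 hB.nonneg
  rw [← mul_assoc, trace_mul_comm, ← mul_assoc, star_eq_conjTranspose]
  exact (hA.mul_mul_conjTranspose_same S).trace_nonneg

/-- Isometries of two definite forms have a product of bounded trace. -/
theorem norm_trace_mul_le {H₁ H₂ A B : Matrix n n ℂ} (h₁ : H₁.PosDef) (h₂ : H₂.PosDef)
    (hA : Aᴴ * H₁ * A = H₁) (hB : Bᴴ * H₂ * B = H₂) :
    2 * ‖(A * B).trace‖ ≤ ((H₂⁻¹ * H₁).trace + (H₁⁻¹ * H₂).trace).re := by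
  have d₁ : IsUnit H₁.det := (isUnit_iff_isUnit_det _).1 h₁.isUnit
  have d₂ : IsUnit H₂.det := (isUnit_iff_isUnit_det _).1 h₂.isUnit
  set t := (A * B).trace with ht
  obtain ⟨ω, hω, hωt⟩ : ∃ ω : ℂ, ‖ω‖ = 1 ∧ star ω * t = ‖t‖ := by
    by_cases h0 : t = 0
    · exact ⟨1, by simp, by simp [h0]⟩
    · have hn : (‖t‖ : ℂ) ≠ 0 := by simpa using h0
      refine ⟨t / ‖t‖, by simp [h0], ?_⟩
      have := Complex.mul_conj t
      rw [Complex.normSq_eq_norm_sq] at this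
      simp only [RCLike.star_def, map_div₀, Complex.conj_ofReal]
      rw [div_mul_eq_mul_div, div_eq_iff hn, mul_comm, this]
      push_cast
      ring
  have hω2 : ω * star ω = 1 := by
    have := Complex.mul_conj ω
    rw [Complex.normSq_eq_norm_sq, hω] at this
    simpa using this
  -- For the inner product `tr (X H₂⁻¹ X'ᴴ H₁)`, this `Y` has pairing `tr (A B)` with `A`, while `A`
  -- and `Y` have the two traces on the right as squared norms. The bound is the nonnegativity of
  -- the squared norm of `A - ω Y`, with `ω` the phase of `t`.
  set Y := H₁⁻¹ * Bᴴ * H₂ with hY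
  have hYc : Yᴴ = H₂ * B * H₁⁻¹ := by
    rw [hY, conjTranspose_mul, conjTranspose_mul, conjTranspose_conjTranspose,
      h₁.isHermitian.inv.eq, h₂.isHermitian.eq, mul_assoc]
  have hpos := trace_mul_nonneg_of_posSemidef
    (h₂.inv.posSemidef.mul_mul_conjTranspose_same (A - ω • Y)) h₁.posSemidef
  have e1 : (A * H₂⁻¹ * Aᴴ * H₁).trace = (H₂⁻¹ * H₁).trace := by
    calc (A * H₂⁻¹ * Aᴴ * H₁).trace = (H₂⁻¹ * (Aᴴ * H₁ * A)).trace := by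
          rw [mul_assoc, mul_assoc, trace_mul_comm]; simp only [mul_assoc]
      _ = _ := by rw [hA]
  have e2 : (A * H₂⁻¹ * Yᴴ * H₁).trace = t := by
    rw [hYc, show A * H₂⁻¹ * (H₂ * B * H₁⁻¹) * H₁ = A * (H₂⁻¹ * H₂) * B * (H₁⁻¹ * H₁) by
      simp only [mul_assoc], nonsing_inv_mul _ d₁, nonsing_inv_mul _ d₂, mul_one, mul_one]
  have e3 : (Y * H₂⁻¹ * Aᴴ * H₁).trace = star t := by
    rw [← e2, ← trace_conjTranspose]
    simp only [conjTranspose_mul, conjTranspose_conjTranspose, h₁.isHermitian.eq,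
      h₂.isHermitian.inv.eq]
    rw [← mul_assoc, ← mul_assoc, trace_mul_comm]
    simp only [mul_assoc]
  have e4 : (Y * H₂⁻¹ * Yᴴ * H₁).trace = (H₁⁻¹ * H₂).trace := by
    rw [hYc, hY, show H₁⁻¹ * Bᴴ * H₂ * H₂⁻¹ * (H₂ * B * H₁⁻¹) * H₁ =
      H₁⁻¹ * (Bᴴ * (H₂ * H₂⁻¹) * H₂ * B) * (H₁⁻¹ * H₁) by simp only [mul_assoc],
      nonsing_inv_mul _ d₁, mul_nonsing_inv _ d₂, mul_one, mul_one, hB]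
  have e : ((A - ω • Y) * H₂⁻¹ * (A - ω • Y)ᴴ * H₁).trace =
      (H₂⁻¹ * H₁).trace + (H₁⁻¹ * H₂).trace - (star ω * t + star (star ω * t)) := by
    simp only [conjTranspose_sub, conjTranspose_smul, sub_mul, mul_sub, Matrix.smul_mul, Matrix.mul_smul,
      trace_sub, trace_smul, smul_eq_mul, e1, e2, e3, e4, star_mul, star_star]
    linear_combination (H₁⁻¹ * H₂).trace * hω2
  rw [e, hωt] at hpos
  have := (Complex.nonneg_iff.1 hpos).1
  simp only [RCLike.star_def, Complex.conj_ofReal, Complex.sub_re, Complex.add_re,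
    Complex.ofReal_re] at this
  rw [Complex.add_re]
  linarith

end Traces

/-! ### Negative lines, isolated fixed points and projections. -/

section Points

variable {J : Matrix (Fin 3) (Fin 3) ℂ}

theorem ne_zero_of_hform_eq {u : Fin 3 → ℂ} (hu : hform J u u = -1) : u ≠ 0 := by
  rintro rfl
  simp [hform] at hu

theorem exists_normalized_rep (hJ : J.IsHermitian) {p : ℙ ℂ (Fin 3 → ℂ)} (hp : p ∈ ball J) :
    ∃ (u : Fin 3 → ℂ) (hu : hform J u u = -1),
      p = Projectivization.mk ℂ u (ne_zero_of_hform_eq hu) := by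
  set r : ℝ := -(hform J p.rep p.rep).re with hr
  have hr0 : 0 < r := neg_pos.2 hp
  have hs : (0 : ℝ) < √r := Real.sqrt_pos.2 hr0
  have hs' : ((√r : ℝ) : ℂ) ≠ 0 := by exact_mod_cast hs.ne'
  have hu : hform J ((((√r)⁻¹ : ℝ) : ℂ) • p.rep) ((((√r)⁻¹ : ℝ) : ℂ) • p.rep) = -1 := by
    rw [hform_smul_smul, hform_self_eq_re hJ, RCLike.star_def, Complex.conj_ofReal,
      show (hform J p.rep p.rep).re = -r by rw [hr]; ring]
    rw [← Complex.ofReal_mul, ← mul_inv, Real.mul_self_sqrt hr0.le, ← Complex.ofReal_mul, mul_neg,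
      inv_mul_cancel₀ hr0.ne']
    simp
  refine ⟨_, hu, ?_⟩
  conv_lhs => rw [← p.mk_rep]
  rw [Projectivization.mk_eq_mk_iff']
  refine ⟨(√r : ℝ), ?_⟩
  rw [smul_smul]
  push_cast
  rw [mul_inv_cancel₀ hs', one_smul]

theorem exists_eigenvalue_of_smul_mk_eq {M : Matrix.SpecialLinearGroup (Fin 3) ℂ} {u : Fin 3 → ℂ}
    {hu : u ≠ 0} (h : M • Projectivization.mk ℂ u hu = Projectivization.mk ℂ u hu) :
    ∃ c : ℂ, (M : Matrix (Fin 3) (Fin 3) ℂ) *ᵥ u = c • u := by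
  rw [Projectivization.smul_mk, Projectivization.mk_eq_mk_iff'] at h
  obtain ⟨c, hc⟩ := h
  exact ⟨c, hc.symm⟩

theorem smul_mk_eq_of_mulVec_eq {M : Matrix.SpecialLinearGroup (Fin 3) ℂ} {u : Fin 3 → ℂ}
    (hu : u ≠ 0) {c : ℂ} (h : (M : Matrix (Fin 3) (Fin 3) ℂ) *ᵥ u = c • u) :
    M • Projectivization.mk ℂ u hu = Projectivization.mk ℂ u hu := by
  rw [Projectivization.smul_mk, Projectivization.mk_eq_mk_iff']
  exact ⟨c, h.symm⟩

theorem tance_mk_of_hform_eq (hJ : J.IsHermitian) {u v : Fin 3 → ℂ} (hu : hform J u u = -1)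
    (hv : hform J v v = -1) :
    tance J (Projectivization.mk ℂ u (ne_zero_of_hform_eq hu))
      (Projectivization.mk ℂ v (ne_zero_of_hform_eq hv)) = Complex.normSq (hform J u v) := by
  rw [tance_mk, hu, hv, ← star_hform hJ u v, RCLike.star_def, Complex.mul_conj]
  norm_num

/-- The reverse Cauchy–Schwarz inequality. -/
theorem one_lt_normSq_hform (h : HasSignatureTwoOne J) {u v : Fin 3 → ℂ}
    (hu : hform J u u = -1) (hv : hform J v v = -1)
    (huv : Projectivization.mk ℂ u (ne_zero_of_hform_eq hu) ≠
      Projectivization.mk ℂ v (ne_zero_of_hform_eq hv)) :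
    1 < Complex.normSq (hform J u v) := by
  have hJ := h.isHermitian
  have hw : u + hform J u v • v ≠ 0 := by
    intro h0
    refine huv ?_
    rw [Projectivization.mk_eq_mk_iff']
    exact ⟨-hform J u v, by rw [neg_smul, neg_eq_iff_add_eq_zero, add_comm, h0]⟩
  have hpos := h.hform_pos (by rw [hv]; simp) (hform_sub_orthogonal hv u) hw
  have := congrArg Complex.re (hform_self_eq hJ hv u)
  rw [hu, RCLike.star_def, Complex.mul_conj, Complex.sub_re, Complex.ofReal_re] at this
  simp only [Complex.neg_re, Complex.one_re] at this
  linarith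

/-- At an isolated fixed point the eigenvalue of the negative eigenvector does not occur on its
orthogonal complement. -/
theorem eq_zero_of_isolated (h : HasSignatureTwoOne J) {M : Matrix.SpecialLinearGroup (Fin 3) ℂ}
    {u : Fin 3 → ℂ} (hu : hform J u u = -1) {c : ℂ}
    (hc : (M : Matrix (Fin 3) (Fin 3) ℂ) *ᵥ u = c • u) {ε : ℝ} (hε : 0 < ε)
    (hiso : ∀ q ∈ fixedLocus J M,
      bergmanDist J (Projectivization.mk ℂ u (ne_zero_of_hform_eq hu)) q < ε →
        q = Projectivization.mk ℂ u (ne_zero_of_hform_eq hu))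
    {w : Fin 3 → ℂ} (hwu : hform J w u = 0)
    (hw : (M : Matrix (Fin 3) (Fin 3) ℂ) *ᵥ w = c • w) : w = 0 := by
  have hJ := h.isHermitian
  by_contra hw0
  have hρ := h.hform_pos (by rw [hu]; simp) hwu hw0
  set ρ := (hform J w w).re with hρd
  have hww : hform J w w = ρ := hform_self_eq_re hJ w
  have huw : hform J u w = 0 := by rw [← star_hform hJ, hwu, star_zero]
  -- Constants are tuned so that `z = u + t w` satisfies `⟨z, z⟩ = -1 / C²`: its line is fixed by
  -- `M` and lies at distance exactly `ε / 2` from `u`.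
  set C := Real.cosh (ε / 4) with hC
  have hC1 : 1 < C := Real.one_lt_cosh.2 (by positivity)
  have hC0 : C ≠ 0 := by positivity
  set t : ℝ := √((1 - (C ^ 2)⁻¹) / ρ) with ht
  have hpos : 0 < (1 - (C ^ 2)⁻¹) / ρ :=
    div_pos (sub_pos.2 (inv_lt_one_of_one_lt₀ (one_lt_pow₀ hC1 two_ne_zero))) hρ
  have ht0 : 0 < t := Real.sqrt_pos.2 hpos
  have ht2 : t ^ 2 * ρ = 1 - (C ^ 2)⁻¹ := by
    rw [ht, Real.sq_sqrt hpos.le, div_mul_cancel₀ _ hρ.ne']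
  set z : Fin 3 → ℂ := u + (t : ℂ) • w with hz
  have hzz : hform J z z = ((-(C ^ 2)⁻¹ : ℝ) : ℂ) := by
    have e : hform J z z = ((-1 + t ^ 2 * ρ : ℝ) : ℂ) := by
      rw [hz]
      simp only [hform_add_left, hform_add_right, hform_smul_left, hform_smul_right, hu, hwu, huw,
        hww, RCLike.star_def, Complex.conj_ofReal]
      push_cast
      ring
    rw [e, ht2]
    congr 1
    ring
  have hneg : (hform J z z).re < 0 := by
    rw [hzz, Complex.ofReal_re, neg_lt_zero]
    positivity
  have hz0 : z ≠ 0 := by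
    intro h0
    rw [h0] at hneg
    simp [hform] at hneg
  have huz : hform J u z = -1 := by
    rw [hz, hform_add_right, hform_smul_right, hu, huw]; ring
  have hzu : hform J z u = -1 := by
    rw [hz, hform_add_left, hform_smul_left, hu, hwu]; ring
  have hfix : Projectivization.mk ℂ z hz0 ∈ fixedLocus J M := by
    refine ⟨(mk_mem_ball_iff J z hz0).2 hneg, smul_mk_eq_of_mulVec_eq hz0 (c := c) ?_⟩
    rw [hz, mulVec_add, mulVec_smul, hc, hw, smul_add, smul_comm]
  have htance : tance J (Projectivization.mk ℂ u (ne_zero_of_hform_eq hu))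
      (Projectivization.mk ℂ z hz0) = C ^ 2 := by
    rw [tance_mk, huz, hzu, hu, hzz,
      show (-1 * -1 / (-1 * ((-(C ^ 2)⁻¹ : ℝ) : ℂ))) = ((C ^ 2 : ℝ) : ℂ) by push_cast; simp,
      Complex.ofReal_re]
  have hdist : bergmanDist J (Projectivization.mk ℂ u (ne_zero_of_hform_eq hu))
      (Projectivization.mk ℂ z hz0) = ε / 2 := by
    rw [bergmanDist, htance, Real.sqrt_sq (by positivity), hC, Real.arcosh_cosh (by positivity)]
    ring
  have heq := hiso _ hfix (by rw [hdist]; linarith)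
  rw [Projectivization.mk_eq_mk_iff'] at heq
  obtain ⟨a, ha⟩ := heq
  have := congrArg (fun x => hform J x w) ha
  simp only [hz, hform_add_left, hform_smul_left, huw, hww] at this
  have h' : (t : ℂ) * ρ = 0 := by linear_combination -this
  norm_cast at h'
  exact (mul_pos ht0 hρ).ne' h'

/-- The orthogonal projection to the negative line of `u`. -/
noncomputable def proj (J : Matrix (Fin 3) (Fin 3) ℂ) (u : Fin 3 → ℂ) :
    Matrix (Fin 3) (Fin 3) ℂ :=
  -vecMulVec u (star u ᵥ* J)

theorem proj_mulVec (u z : Fin 3 → ℂ) : proj J u *ᵥ z = -hform J z u • u := by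
  rw [proj, neg_mulVec, vecMulVec_mulVec, op_smul_eq_smul, ← dotProduct_mulVec, neg_smul]
  rfl

theorem trace_proj_mul_proj (u v : Fin 3 → ℂ) :
    (proj J u * proj J v).trace = hform J u v * hform J v u := by
  rw [proj, proj, neg_mul_neg, vecMulVec_mul_vecMulVec, trace_vecMulVec, dotProduct_smul,
    ← dotProduct_mulVec, dotProduct_comm u, ← dotProduct_mulVec, smul_eq_mul, mul_comm]
  rfl

theorem conjTranspose_proj_mul (hJ : J.IsHermitian) (u : Fin 3 → ℂ) :
    (proj J u)ᴴ * J = J * proj J u := by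
  rw [proj, conjTranspose_neg, conjTranspose_vecMulVec, star_vecMul_eq hJ, star_star, neg_mul,
    mul_neg, vecMulVec_mul, mul_vecMulVec, star_vecMul_eq hJ]

theorem coe_aeval_restrict {V : Type*} [AddCommGroup V] [Module ℂ V] {W : Submodule ℂ V}
    {f : Module.End ℂ V} (hf : ∀ x ∈ W, f x ∈ W) (p : ℂ[X]) (x : W) :
    (aeval (f.restrict hf) p x : V) = aeval f p (x : V) := by
  simp only [aeval_eq_sum_range, LinearMap.sum_apply, LinearMap.smul_apply, Submodule.coe_sum,
    Submodule.coe_smul, Module.End.pow_restrict _ hf, LinearMap.coe_restrict_apply]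

/-- If the eigenvalue of the negative eigenvector `u` does not occur on its orthogonal complement,
then the projection to `u` is a polynomial in the isometry. -/
theorem exists_aeval_eq_proj {M : Matrix (Fin 3) (Fin 3) ℂ}
    (hM : Mᴴ * J * M = J) {u : Fin 3 → ℂ} (hu : hform J u u = -1) {c : ℂ} (hc : M *ᵥ u = c • u)
    (hiso : ∀ w, hform J w u = 0 → M *ᵥ w = c • w → w = 0) :
    ∃ p : ℂ[X], aeval M p = proj J u := by
  have hc1 : c * star c = 1 := by
    have := hform_mulVec_mulVec hM u u
    rw [hc, hform_smul_smul, hu] at this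
    linear_combination -this
  let ℓ : (Fin 3 → ℂ) →ₗ[ℂ] ℂ :=
    { toFun := fun z => hform J z u
      map_add' := fun _ _ => hform_add_left _ _ _ _
      map_smul' := fun _ _ => hform_smul_left _ _ _ _ }
  let f : Module.End ℂ (Fin 3 → ℂ) := toLinAlgEquiv' M
  have hf (z) : f z = M *ᵥ z := toLinAlgEquiv'_apply M z
  have hW : ∀ x ∈ LinearMap.ker ℓ, f x ∈ LinearMap.ker ℓ := by
    intro x hx
    change hform J x u = 0 at hx
    change hform J (f x) u = 0
    have h1 := hform_mulVec_mulVec hM x u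
    rw [hc, hform_smul_right, hx] at h1
    rw [hf]
    linear_combination c * h1 - hform J (M *ᵥ x) u * hc1
  set g := f.restrict hW with hg
  have hq : g.charpoly.eval c ≠ 0 := by
    intro h0
    obtain ⟨w, hw⟩ := ((Module.End.hasEigenvalue_iff_isRoot_charpoly g c).2 h0).exists_hasEigenvector
    refine hw.2 (Subtype.ext (hiso w w.2 ?_))
    have := congrArg Subtype.val hw.apply_eq_smul
    rwa [hg, LinearMap.coe_restrict_apply, hf] at this
  -- By Cayley–Hamilton the characteristic polynomial of the restriction kills the complement of
  -- `u`; on `u` it acts by its value at `c`, nonzero since `c` is not an eigenvalue there.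
  refine ⟨C (g.charpoly.eval c)⁻¹ * g.charpoly, ?_⟩
  apply toLinAlgEquiv'.injective
  rw [← aeval_algHom_apply (toLinAlgEquiv' : Matrix (Fin 3) (Fin 3) ℂ ≃ₐ[ℂ] _)]
  change aeval f _ = _
  refine LinearMap.ext fun z => ?_
  have hzW : z + hform J z u • u ∈ LinearMap.ker ℓ := hform_sub_orthogonal hu z
  have h0 : aeval f g.charpoly (z + hform J z u • u) = 0 := by
    have := coe_aeval_restrict hW g.charpoly ⟨_, hzW⟩
    rw [← hg, LinearMap.aeval_self_charpoly] at this
    simpa using this.symm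
  have hcu : f u = c • u := by rw [hf, hc]
  rw [map_add, map_smul, Module.End.aeval_apply_of_mem_apply_eq_smul hcu] at h0
  rw [map_mul, aeval_C, Module.End.mul_apply, Module.algebraMap_end_apply,
    eq_neg_of_add_eq_zero_left h0, toLinAlgEquiv'_apply, proj_mulVec, smul_neg, neg_smul,
    smul_comm (hform J z u), smul_smul, inv_mul_cancel₀ hq, one_smul]

end Points

/-! ### Gaps between conjugates in a quadratic field. -/

section QuadraticDiscriminant

theorem algebraMap_discr_one_pair {K L : Type*} [Field K] [Field L] [Algebra K L]
    [FiniteDimensional K L] [Algebra.IsSeparable K L] [Algebra K ℂ] (s : L)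
    (e : Fin 2 ≃ (L →ₐ[K] ℂ)) :
    algebraMap K ℂ (Algebra.discr K ![1, s]) = (e 1 s - e 0 s) ^ 2 := by
  rw [Algebra.discr_eq_det_embeddingsMatrixReindex_pow_two K ℂ _ e, det_fin_two]
  simp [Algebra.embeddingsMatrixReindex, Algebra.embeddingsMatrix]

/-- An integer of a quadratic field whose two conjugates differ is not in `ℤ`, so that these
differ by at least the square root of the discriminant. -/
theorem eq_of_norm_sub_sq_lt_discr {K : Type*} [Field K] [NumberField K]
    [Algebra.IsQuadraticExtension ℚ K] (s : 𝓞 K) (ψ₁ ψ₂ : K →+* ℂ)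
    (h : ‖ψ₁ s - ψ₂ s‖ ^ 2 < (discr K : ℝ)) : ψ₁ s = ψ₂ s := by
  by_contra hne
  have hfin : Module.finrank ℚ K = 2 := Algebra.IsQuadraticExtension.finrank_eq_two ℚ K
  have hinj : Function.Injective ![ψ₁.toRatAlgHom, ψ₂.toRatAlgHom] := by
    have h12 : ψ₁.toRatAlgHom ≠ ψ₂.toRatAlgHom := fun h' =>
      hne (by simpa using DFunLike.congr_fun h' (s : K))
    intro i j hij
    fin_cases i <;> fin_cases j <;> simp_all
  have hcard : Fintype.card (K →ₐ[ℚ] ℂ) = 2 := by rw [AlgHom.card, hfin]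
  let e : Fin 2 ≃ (K →ₐ[ℚ] ℂ) := Equiv.ofBijective _
    ((Fintype.bijective_iff_injective_and_card _).2 ⟨hinj, by rw [hcard]; simp⟩)
  have h1 := algebraMap_discr_one_pair (K := ℚ) (s : K) e
  have he0 : e 0 = ψ₁.toRatAlgHom := rfl
  have he1 : e 1 = ψ₂.toRatAlgHom := rfl
  rw [he0, he1, RingHom.toRatAlgHom_apply, RingHom.toRatAlgHom_apply] at h1
  have hι : Fintype.card (Module.Free.ChooseBasisIndex ℤ (𝓞 K)) = 2 := by
    rw [← Module.finrank_eq_card_chooseBasisIndex, RingOfIntegers.rank, hfin]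
  let r := Fintype.equivFinOfCardEq hι
  let ω := (integralBasis K).reindex r
  let b : Fin 2 → 𝓞 K := ![1, s]
  let P : Matrix (Fin 2) (Fin 2) ℤ := fun i j => (RingOfIntegers.basis K).repr (b j) (r.symm i)
  have hP : ω.toMatrix ![1, (s : K)] = P.map (algebraMap ℤ ℚ) := by
    ext i j
    have hb : ![1, (s : K)] j = algebraMap (𝓞 K) K (b j) := by
      fin_cases j <;> simp [b]
    rw [Module.Basis.toMatrix_apply, hb, Module.Basis.repr_reindex_apply, integralBasis_repr_apply]
    rfl
  -- The pair `1, s` has integral coordinates, so its discriminant is a square integer multiple of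
  -- that of `K`; the multiple is nonzero as the conjugates differ.
  have h2 : Algebra.discr ℚ ![1, (s : K)] = ((P.det ^ 2 * discr K : ℤ) : ℚ) := by
    have hd : Algebra.discr ℚ ω = discr K := by
      rw [coe_discr, ← Algebra.discr_reindex ℚ (integralBasis K) r, Module.Basis.coe_reindex]
    rw [← ω.toMatrix_map_vecMul ![1, (s : K)], Algebra.discr_of_matrix_vecMul, hd, hP,
      ← RingHom.mapMatrix_apply, ← RingHom.map_det]
    simp
  rw [h2, map_intCast] at h1
  have hdet : P.det ≠ 0 := by
    intro h0
    rw [h0] at h1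
    simp only [ne_eq, OfNat.ofNat_ne_zero, not_false_eq_true, zero_pow, zero_mul, Int.cast_zero] at h1
    exact hne (sub_eq_zero.1 ((pow_eq_zero_iff two_ne_zero).1 h1.symm)).symm
  have h3 : ‖ψ₁ s - ψ₂ s‖ ^ 2 = ((P.det ^ 2 * |discr K| : ℤ) : ℝ) := by
    rw [norm_sub_rev, ← norm_pow, ← h1, Complex.norm_intCast, ← Int.cast_abs, abs_mul,
      abs_of_nonneg (sq_nonneg P.det)]
  rw [h3, Int.cast_lt] at h
  have h4 : 1 ≤ P.det ^ 2 := by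
    have := sq_nonneg P.det
    have := pow_ne_zero 2 hdet
    omega
  nlinarith [le_abs_self (discr K), abs_nonneg (discr K)]

end QuadraticDiscriminant

/-! ### Integers of a CM extension of a real quadratic field. -/

section CM

variable (K : Type u) {F : Type v} [Field K] [NumberField K] [Field F] [NumberField F]
  [Algebra K F] [Algebra.IsQuadraticExtension K F]

/-- An element fixed by complex conjugation lies in `K`, where the discriminant gap applies. -/
theorem embedding_eq_of_complexConj_eq [Algebra.IsQuadraticExtension ℚ K]
    [IsTotallyReal K] [IsCMField F] {s : F}
    (hs : IsIntegral ℤ s) (hc : IsCMField.complexConj F s = s) (φ₁ φ₂ : F →+* ℂ)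
    (h : ‖φ₁ s - φ₂ s‖ ^ 2 < (discr K : ℝ)) : φ₁ s = φ₂ s := by
  rw [IsCMField.complexConj_eq_self_iff] at hc
  have ht := CMExtension.algebraMap_equivMaximalRealSubfield_symm_apply K F ⟨s, hc⟩
  change algebraMap K F _ = s at ht
  generalize (CMExtension.equivMaximalRealSubfield K F).symm ⟨s, hc⟩ = t at ht
  subst ht
  have hint : IsIntegral ℤ t :=
    (isIntegral_algebraMap_iff (FaithfulSMul.algebraMap_injective K F)).1 hs
  exact eq_of_norm_sub_sq_lt_discr ⟨t, hint⟩ (φ₁.comp (algebraMap K F))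
    (φ₂.comp (algebraMap K F)) h

theorem exists_embedding_ne [Algebra.IsQuadraticExtension ℚ K] (σ : F →+* ℂ) :
    ∃ φ : F →+* ℂ, φ ≠ σ ∧ φ ≠ ComplexEmbedding.conjugate σ := by
  classical
  by_contra! hcon
  have hF : Module.finrank ℚ F = 4 := by
    rw [← Module.finrank_mul_finrank ℚ K F, Algebra.IsQuadraticExtension.finrank_eq_two ℚ K,
      Algebra.IsQuadraticExtension.finrank_eq_two K F]
  have hcard := Embeddings.card F ℂ
  rw [hF] at hcard
  have hsub : (Finset.univ : Finset (F →+* ℂ)) ⊆ {σ, ComplexEmbedding.conjugate σ} := by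
    intro φ _
    by_cases h : φ = σ
    · simp [h]
    · simp [hcon φ h]
  have := (Finset.card_le_card hsub).trans Finset.card_le_two
  rw [Finset.card_univ, hcard] at this
  omega

/-- Over a real quadratic field of large discriminant, an integer of `F` which is bounded at one
place and at most `3` at the other takes the same value in all complex embeddings. -/
theorem NoSmallNonrealInteger.embedding_eq [Algebra.IsQuadraticExtension ℚ K]
    [IsTotallyReal K] [IsCMField F]
    (hF : NoSmallNonrealInteger F) {C : ℝ} (hC : 3 ≤ C) (hD : (2 * C ^ 2) ^ 2 < (discr K : ℝ))
    {σ : F →+* ℂ} {z : 𝓞 F} (hσ : ‖σ z‖ ≤ C)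
    (hz : ∀ φ : F →+* ℂ, φ ≠ σ → φ ≠ ComplexEmbedding.conjugate σ → ‖φ z‖ ≤ 3)
    (φ : F →+* ℂ) : φ z = σ z := by
  have hbound (φ : F →+* ℂ) : ‖φ z‖ ≤ C := by
    by_cases h1 : φ = σ
    · rwa [h1]
    by_cases h2 : φ = ComplexEmbedding.conjugate σ
    · rw [h2, ComplexEmbedding.conjugate_coe_eq, Complex.norm_conj]
      exact hσ
    · exact (hz φ h1 h2).trans hC
  have hzi : IsIntegral ℤ (z : F) := z.isIntegral_coe
  have hci : IsIntegral ℤ (IsCMField.complexConj F (z : F)) :=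
    hzi.map ((IsCMField.complexConj F).toRingEquiv.toRingHom.toIntAlgHom)
  -- `z z̄` lies in `K` with values `|φ z|² ≤ C²`, so the gap makes the absolute value of `z`
  -- independent of the embedding.
  have hn (φ : F →+* ℂ) : ‖φ z‖ = ‖σ z‖ := by
    have hval (φ : F →+* ℂ) :
        φ ((z : F) * IsCMField.complexConj F (z : F)) = ((‖φ z‖ ^ 2 : ℝ) : ℂ) := by
      rw [map_mul, IsCMField.complexEmbedding_complexConj, Complex.mul_conj,
        Complex.normSq_eq_norm_sq]
    have := embedding_eq_of_complexConj_eq K (hzi.mul hci)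
      (by rw [map_mul, IsCMField.complexConj_apply_apply, mul_comm]) φ σ (by
        refine lt_of_le_of_lt ?_ hD
        gcongr
        rw [hval, hval]
        refine (norm_sub_le _ _).trans ?_
        rw [Complex.norm_of_nonneg (by positivity), Complex.norm_of_nonneg (by positivity), two_mul]
        gcongr
        exact hbound _)
    rw [hval, hval, Complex.ofReal_inj] at this
    exact (pow_left_inj₀ (norm_nonneg _) (norm_nonneg _) two_ne_zero).1 this
  obtain ⟨φ₀, h1, h2⟩ := exists_embedding_ne K σ
  -- The common absolute value is at most 3, as seen at the second place, so (∗) makes `z` totally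
  -- real. Then `z + z̄` has values `2 φ z`, which differ by at most `4 C ≤ 2 C²`.
  have him := hF z fun φ => by rw [hn φ, ← hn φ₀]; exact hz φ₀ h1 h2
  have hval (φ : F →+* ℂ) : φ ((z : F) + IsCMField.complexConj F (z : F)) = 2 * φ z := by
    rw [map_add, IsCMField.complexEmbedding_complexConj, Complex.conj_eq_iff_im.2 (him φ), two_mul]
  have := embedding_eq_of_complexConj_eq K (hzi.add hci)
    (by rw [map_add, IsCMField.complexConj_apply_apply, add_comm]) φ σ (by
      refine lt_of_le_of_lt ?_ hD
      gcongr
      rw [hval, hval]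
      refine (norm_sub_le _ _).trans ?_
      rw [norm_mul, norm_mul, Complex.norm_ofNat]
      nlinarith [hbound φ, hbound σ])
  rw [hval, hval] at this
  exact mul_left_cancel₀ two_ne_zero this

variable {K} in
theorem norm_discr_one_pair_le {z : F} (hz : ∀ φ : F →+* ℂ, ‖φ z‖ ≤ 3) (ψ : K →+* ℂ) :
    ‖ψ (Algebra.discr K ![1, z])‖ ≤ 36 := by
  let := ψ.toAlgebra
  have hcard : Fintype.card (F →ₐ[K] ℂ) = 2 := by
    rw [AlgHom.card, Algebra.IsQuadraticExtension.finrank_eq_two K F]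
  let e := (Fintype.equivFinOfCardEq hcard).symm
  change ‖algebraMap K ℂ _‖ ≤ 36
  rw [algebraMap_discr_one_pair z e, norm_pow, show (36 : ℝ) = 6 ^ 2 by norm_num]
  gcongr
  refine (norm_sub_le _ _).trans ?_
  have h1 := hz (e 1 : F →+* ℂ)
  have h0 := hz (e 0 : F →+* ℂ)
  simp only [RingHom.coe_coe] at h0 h1
  linarith

/-- An integer of `F` that is small and not totally real bounds the relative discriminant. -/
theorem absNorm_relDiscr_le [Algebra.IsQuadraticExtension ℚ K] [IsTotallyReal K]
    (h : ¬ NoSmallNonrealInteger F) : Ideal.absNorm (relDiscr K F) ≤ 1296 := by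
  simp only [NoSmallNonrealInteger, not_forall] at h
  obtain ⟨z, hz, φ, hφ⟩ := h
  have hfin : Module.finrank K F = 2 := Algebra.IsQuadraticExtension.finrank_eq_two K F
  have hli : LinearIndependent K ![(1 : F), (z : F)] := by
    rw [LinearIndependent.pair_iff' one_ne_zero]
    intro a ha
    refine hφ ?_
    rw [← ha, Algebra.smul_def, mul_one, ← Complex.conj_eq_iff_im]
    exact DFunLike.congr_fun
      (IsTotallyReal.complexEmbedding_isReal (φ.comp (algebraMap K F))) a
  let b₀ := basisOfLinearIndependentOfCardEqFinrank hli (by rw [hfin]; simp)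
  let b := b₀.reindex (finCongr hfin.symm)
  have hb₀ (i) : IsIntegral ℤ (b₀ i) := by
    rw [coe_basisOfLinearIndependentOfCardEqFinrank]
    fin_cases i
    · exact isIntegral_one
    · exact z.isIntegral_coe
  have hb (i) : IsIntegral ℤ (b i) := by
    rw [Module.Basis.reindex_apply]
    exact hb₀ _
  have hdb : Algebra.discr K b = Algebra.discr K ![1, (z : F)] := by
    rw [Module.Basis.coe_reindex, Algebra.discr_reindex,
      coe_basisOfLinearIndependentOfCardEqFinrank]
  let d : 𝓞 K := ⟨Algebra.discr K b, Algebra.discr_isIntegral K hb⟩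
  have hd0 : d ≠ 0 := fun h0 =>
    Algebra.discr_not_zero_of_basis K b (congrArg (algebraMap (𝓞 K) K) h0)
  have hmem : d ∈ relDiscr K F := Ideal.subset_span ⟨b, hb, rfl⟩
  -- The norm of a nonzero member of an ideal is a nonzero multiple of the norm of the ideal.
  have hle : Ideal.absNorm (relDiscr K F) ≤ (Algebra.norm ℤ d).natAbs :=
    Nat.le_of_dvd (Int.natAbs_pos.2 (Algebra.norm_ne_zero_iff.2 hd0))
      (Int.natCast_dvd.1 (Ideal.absNorm_dvd_norm_of_mem hmem))
  refine hle.trans ?_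
  have hnorm : ‖((Algebra.norm ℤ d : ℤ) : ℂ)‖ ≤ 1296 := by
    have : ((Algebra.norm ℤ d : ℤ) : ℂ) = algebraMap ℚ ℂ (Algebra.norm ℚ (d : K)) := by
      rw [← Algebra.coe_norm_int, map_intCast]
    rw [this, Algebra.norm_eq_prod_embeddings ℚ ℂ, norm_prod]
    refine (Finset.prod_le_prod (fun _ _ => norm_nonneg _)
      (g := fun _ => (36 : ℝ)) fun ψ _ => ?_).trans ?_
    · change ‖(ψ : K →+* ℂ) (Algebra.discr K b)‖ ≤ 36
      rw [hdb]
      exact norm_discr_one_pair_le hz _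
    · rw [Finset.prod_const, Finset.card_univ, AlgHom.card,
        Algebra.IsQuadraticExtension.finrank_eq_two ℚ K]
      norm_num
  rw [Complex.norm_intCast, ← Int.cast_abs, Int.abs_eq_natAbs] at hnorm
  exact_mod_cast hnorm

end CM

/-! ### Traces of isometries and their Gram form. -/

section Isometries

variable {J : Matrix (Fin 3) (Fin 3) ℂ}

theorem coe_inv_of_mem_specialUnitary (hJ : IsUnit J.det) {g : Matrix.SpecialLinearGroup (Fin 3) ℂ}
    (hg : g ∈ specialUnitary J) :
    ((g⁻¹ : Matrix.SpecialLinearGroup (Fin 3) ℂ) : Matrix (Fin 3) (Fin 3) ℂ) =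
      J⁻¹ * (g : Matrix (Fin 3) (Fin 3) ℂ)ᴴ * J := by
  have hg' : (g : Matrix (Fin 3) (Fin 3) ℂ)ᴴ * J * (g : Matrix (Fin 3) (Fin 3) ℂ) = J := hg
  have h1 : (g : Matrix (Fin 3) (Fin 3) ℂ) *
      ((g⁻¹ : Matrix.SpecialLinearGroup (Fin 3) ℂ) : Matrix (Fin 3) (Fin 3) ℂ) = 1 := by
    rw [← Matrix.SpecialLinearGroup.coe_mul, mul_inv_cancel, Matrix.SpecialLinearGroup.coe_one]
  have h2 : J⁻¹ * (g : Matrix (Fin 3) (Fin 3) ℂ)ᴴ * J * (g : Matrix (Fin 3) (Fin 3) ℂ) = 1 := by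
    rw [mul_assoc, mul_assoc, ← mul_assoc _ J, hg', nonsing_inv_mul _ hJ]
  exact (left_inv_eq_right_inv h2 h1).symm

/-- The Gram matrix of the traces of a family of isometries evaluates the form
`tr (Z * Z^*)`, where `Z^* = J⁻¹ Zᴴ J`. -/
theorem sum_trace_mul_inv {ι : Type*} [Fintype ι] (hJ : IsUnit J.det)
    {g : ι → Matrix.SpecialLinearGroup (Fin 3) ℂ} (hg : ∀ i, g i ∈ specialUnitary J) (c : ι → ℂ) :
    ∑ i, ∑ j, c i * star (c j) * ((g i * (g j)⁻¹ : Matrix.SpecialLinearGroup (Fin 3) ℂ) :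
      Matrix (Fin 3) (Fin 3) ℂ).trace =
    ((∑ i, c i • (g i : Matrix (Fin 3) (Fin 3) ℂ)) *
      (J⁻¹ * (∑ i, c i • (g i : Matrix (Fin 3) (Fin 3) ℂ))ᴴ * J)).trace := by
  simp only [Matrix.SpecialLinearGroup.coe_mul, coe_inv_of_mem_specialUnitary hJ (hg _),
    conjTranspose_sum, conjTranspose_smul, Finset.sum_mul, Finset.mul_sum, Matrix.smul_mul,
    Matrix.mul_smul, trace_sum, trace_smul, smul_eq_mul]
  rw [Finset.sum_comm]
  refine Finset.sum_congr rfl fun i _ => Finset.sum_congr rfl fun j _ => ?_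
  ring

theorem specialUnitary_neg : specialUnitary (-J) = specialUnitary J := by
  ext g
  change _ * -J * _ = -J ↔ _ * J * _ = J
  rw [mul_neg, neg_mul, neg_inj]

/-- For definite `J` the form is the trace of a product of two positive semidefinite matrices;
passing to `-J` does not change the group. -/
theorem sum_trace_mul_inv_nonneg {ι : Type*} [Fintype ι] (hJ : J.PosDef ∨ (-J).PosDef)
    {g : ι → Matrix.SpecialLinearGroup (Fin 3) ℂ} (hg : ∀ i, g i ∈ specialUnitary J) (c : ι → ℂ) :
    0 ≤ ∑ i, ∑ j, c i * star (c j) * ((g i * (g j)⁻¹ : Matrix.SpecialLinearGroup (Fin 3) ℂ) :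
      Matrix (Fin 3) (Fin 3) ℂ).trace := by
  wlog h : J.PosDef generalizing J
  · exact this (J := -J) (Or.inl (hJ.resolve_left h)) (by rwa [specialUnitary_neg])
      (hJ.resolve_left h)
  rw [sum_trace_mul_inv ((isUnit_iff_isUnit_det _).1 h.isUnit) hg, ← mul_assoc, ← mul_assoc]
  exact trace_mul_nonneg_of_posSemidef (h.inv.posSemidef.mul_mul_conjTranspose_same _)
    h.posSemidef

theorem norm_trace_le_three {g : Matrix.SpecialLinearGroup (Fin 3) ℂ} (hJ : J.PosDef ∨ (-J).PosDef)
    (hg : g ∈ specialUnitary J) : ‖(g : Matrix (Fin 3) (Fin 3) ℂ).trace‖ ≤ 3 := by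
  wlog h : J.PosDef generalizing J
  · exact this (J := -J) (Or.inl (hJ.resolve_left h)) (by rwa [specialUnitary_neg])
      (hJ.resolve_left h)
  have := norm_trace_mul_le (B := 1) h h hg (by simp)
  rw [mul_one, nonsing_inv_mul _ ((isUnit_iff_isUnit_det _).1 h.isUnit), trace_one,
    Fintype.card_fin, Complex.add_re] at this
  norm_num at this
  linarith

/-- `a` and `b` are isometries of the definite forms flipped at `u` and at `v`, so the trace
inequality applies to them. -/
theorem norm_trace_mul_le_of_fix (h : HasSignatureTwoOne J) {a b : Matrix.SpecialLinearGroup (Fin 3) ℂ}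
    (ha : a ∈ specialUnitary J) (hb : b ∈ specialUnitary J) {u v : Fin 3 → ℂ}
    (hu : hform J u u = -1) (hv : hform J v v = -1)
    (hau : a • Projectivization.mk ℂ u (ne_zero_of_hform_eq hu) =
      Projectivization.mk ℂ u (ne_zero_of_hform_eq hu))
    (hbv : b • Projectivization.mk ℂ v (ne_zero_of_hform_eq hv) =
      Projectivization.mk ℂ v (ne_zero_of_hform_eq hv)) :
    ‖((a * b : Matrix.SpecialLinearGroup (Fin 3) ℂ) : Matrix (Fin 3) (Fin 3) ℂ).trace‖ ≤
      4 * Complex.normSq (hform J u v) - 1 := by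
  obtain ⟨α, hα⟩ := exists_eigenvalue_of_smul_mk_eq hau
  obtain ⟨β, hβ⟩ := exists_eigenvalue_of_smul_mk_eq hbv
  have hJ := h.isHermitian
  have := norm_trace_mul_le (posDef_flip h hu) (posDef_flip h hv) (flip_isometry hJ ha hu hα)
    (flip_isometry hJ hb hv hβ)
  rw [trace_inv_flip_mul_flip h hu hv, trace_inv_flip_mul_flip h hv hu, mul_comm (hform J v u),
    ← star_hform hJ u v, RCLike.star_def, Complex.mul_conj] at this
  have e : (4 * (Complex.normSq (hform J u v) : ℂ) - 1 + (4 * (Complex.normSq (hform J u v) : ℂ) - 1))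
      = ((2 * (4 * Complex.normSq (hform J u v) - 1) : ℝ) : ℂ) := by
    push_cast; ring
  rw [e, Complex.ofReal_re] at this
  rw [Matrix.SpecialLinearGroup.coe_mul]
  linarith

/-- Both projections are self-adjoint for `J`, so this is `tr (P_u - P_v)²`. Distinct negative lines
make it negative, which a definite form would forbid. -/
theorem trace_proj_sub_proj_sq (hJ : J.IsHermitian)
    (hdet : IsUnit J.det) {u v : Fin 3 → ℂ} (hu : hform J u u = -1) (hv : hform J v v = -1) :
    ((proj J u - proj J v) * (J⁻¹ * (proj J u - proj J v)ᴴ * J)).trace =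
      ((2 - 2 * Complex.normSq (hform J u v) : ℝ) : ℂ) := by
  rw [mul_assoc J⁻¹, conjTranspose_sub, sub_mul (proj J u)ᴴ, conjTranspose_proj_mul hJ,
    conjTranspose_proj_mul hJ, ← mul_sub, ← mul_assoc J⁻¹, nonsing_inv_mul _ hdet, one_mul]
  simp only [sub_mul, mul_sub, trace_sub, trace_proj_mul_proj, hu, hv]
  have := Complex.mul_conj (hform J u v)
  rw [← RCLike.star_def, star_hform hJ] at this
  push_cast
  linear_combination -2 * this

end Isometries

/-! ### Lattice elements under the various embeddings of the field. -/

section Lattice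

variable {F : Type v} [Field F]

/-- The embedding of `SL₃(𝓞 F)` into `SL₃(ℂ)` induced by a complex embedding of `F`. -/
noncomputable def slEmbedding (σ : F →+* ℂ) :
    Matrix.SpecialLinearGroup (Fin 3) (𝓞 F) →* Matrix.SpecialLinearGroup (Fin 3) ℂ :=
  Matrix.SpecialLinearGroup.map (σ.comp (algebraMap (𝓞 F) F))

theorem trace_slEmbedding (σ : F →+* ℂ) (m : Matrix.SpecialLinearGroup (Fin 3) (𝓞 F)) :
    (slEmbedding σ m : Matrix (Fin 3) (Fin 3) ℂ).trace =
      σ ((m : Matrix (Fin 3) (Fin 3) (𝓞 F)).trace : 𝓞 F) := by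
  exact (map_sum (σ.comp (algebraMap (𝓞 F) F)) _ _).symm

variable {J : Matrix (Fin 3) (Fin 3) F}

theorem exists_slEmbedding_of_mem {σ₁ : F →+* ℂ} {M : Matrix.SpecialLinearGroup (Fin 3) ℂ}
    (hM : M ∈ arithmeticLattice σ₁ J) :
    ∃ m, slEmbedding σ₁ m = M ∧ slEmbedding σ₁ m ∈ specialUnitary (J.map σ₁) := by
  obtain ⟨h1, m, rfl⟩ := hM
  exact ⟨m, rfl, h1⟩

/-- An isolated elliptic point has a representative `u` to which the projection is a polynomial
in an element of the lattice. -/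
theorem IsIsolatedEllipticPoint.exists_aeval_eq_proj {σ₁ : F →+* ℂ}
    (hJ : HasSignatureTwoOne (J.map σ₁)) {x : ℙ ℂ (Fin 3 → ℂ)}
    (hx : IsIsolatedEllipticPoint (J.map σ₁) (arithmeticLattice σ₁ J) x) :
    ∃ (u : Fin 3 → ℂ) (hu : hform (J.map σ₁) u u = -1) (m : Matrix.SpecialLinearGroup (Fin 3) (𝓞 F))
      (p : ℂ[X]), x = Projectivization.mk ℂ u (ne_zero_of_hform_eq hu) ∧
      slEmbedding σ₁ m ∈ specialUnitary (J.map σ₁) ∧ slEmbedding σ₁ m • x = x ∧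
      aeval (slEmbedding σ₁ m : Matrix (Fin 3) (Fin 3) ℂ) p = proj (J.map σ₁) u := by
  obtain ⟨M, hM, -, ⟨hxb, hMx⟩, ε, hε, hiso⟩ := hx
  obtain ⟨m, rfl, hm⟩ := exists_slEmbedding_of_mem hM
  obtain ⟨u, hu, rfl⟩ := exists_normalized_rep hJ.isHermitian hxb
  obtain ⟨c, hc⟩ := exists_eigenvalue_of_smul_mk_eq hMx
  obtain ⟨p, hp⟩ := BallQuotient.exists_aeval_eq_proj hm hu hc
    fun w hwu hw => eq_zero_of_isolated hJ hu hc hε hiso hwu hw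
  exact ⟨u, hu, m, p, rfl, hm, hMx, hp⟩

variable [NumberField F] [IsCMField F]

/-- Unitarity with respect to `J` does not depend on the embedding. -/
theorem slEmbedding_mem_specialUnitary {σ₁ : F →+* ℂ} {m : Matrix.SpecialLinearGroup (Fin 3) (𝓞 F)}
    (h : slEmbedding σ₁ m ∈ specialUnitary (J.map σ₁)) (σ : F →+* ℂ) :
    slEmbedding σ m ∈ specialUnitary (J.map σ) := by
  set A := (m : Matrix (Fin 3) (Fin 3) (𝓞 F)).map (algebraMap (𝓞 F) F) with hA
  have key (τ : F →+* ℂ) : ((A.map (IsCMField.complexConj F))ᵀ * J * A).map τ =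
      (A.map τ)ᴴ * J.map τ * A.map τ := by
    rw [Matrix.map_mul, Matrix.map_mul]
    congr 2
    ext i j
    simp [IsCMField.complexEmbedding_complexConj]
  -- Complex conjugation commutes with every embedding, so unitarity at `σ₁` descends to an identity
  -- over `F` and can be transported to `σ`.
  have h1 : ((A.map (IsCMField.complexConj F))ᵀ * J * A).map σ₁ = J.map σ₁ := (key σ₁).trans h
  have h2 := Matrix.map_injective σ₁.injective h1
  change (A.map σ)ᴴ * J.map σ * A.map σ = J.map σ
  rw [← key σ, h2]

theorem IsAdmissibleForm.posDef_or_neg {σ₁ : F →+* ℂ} (hJ : IsAdmissibleForm σ₁ J)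
    {σ : F →+* ℂ} (h : σ ≠ σ₁) (h' : σ ≠ ComplexEmbedding.conjugate σ₁) :
    (J.map σ).PosDef ∨ (-(J.map σ)).PosDef := by
  have hH : (J.map σ).IsHermitian := by
    ext i j
    rw [conjTranspose_apply, map_apply, map_apply, RCLike.star_def,
      ← IsCMField.complexEmbedding_complexConj, hJ.isHermitian]
  refine (hJ.definite σ h h').imp (fun hp => ?_) (fun hn => ?_)
  · rw [posDef_iff_dotProduct_mulVec]
    refine ⟨hH, fun z hz => ?_⟩
    change 0 < hform (J.map σ) z z
    rw [hform_self_eq_re hH, Complex.zero_lt_real]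
    exact hp z hz
  · rw [posDef_iff_dotProduct_mulVec]
    refine ⟨hH.neg, fun z hz => ?_⟩
    rw [neg_mulVec, dotProduct_neg]
    change 0 < -hform (J.map σ) z z
    rw [hform_self_eq_re hH, ← Complex.ofReal_neg, Complex.zero_lt_real]
    exact neg_pos.2 (hn z hz)

/-- If the projections to `u` and `v` are polynomials in the isometries `m` and `n`, and the traces
of the products of powers of `m` and `n` agree under an indefinite and a definite embedding, then
`u` and `v` cannot be two distinct negative lines. -/
theorem normSq_hform_le_one_of_trace_eq {σ₁ σ₂ : F →+* ℂ} (hJ : IsAdmissibleForm σ₁ J)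
    (h₂ : σ₂ ≠ σ₁) (h₂' : σ₂ ≠ ComplexEmbedding.conjugate σ₁)
    {u v : Fin 3 → ℂ} (hu : hform (J.map σ₁) u u = -1) (hv : hform (J.map σ₁) v v = -1)
    {m n : Matrix.SpecialLinearGroup (Fin 3) (𝓞 F)} {p q : ℂ[X]}
    (hm : slEmbedding σ₁ m ∈ specialUnitary (J.map σ₁))
    (hn : slEmbedding σ₁ n ∈ specialUnitary (J.map σ₁))
    (hp : aeval (slEmbedding σ₁ m : Matrix (Fin 3) (Fin 3) ℂ) p = proj (J.map σ₁) u)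
    (hq : aeval (slEmbedding σ₁ n : Matrix (Fin 3) (Fin 3) ℂ) q = proj (J.map σ₁) v)
    (htr : ∀ a ∈ ({m, n} : Set _), ∀ b ∈ ({m, n} : Set _), ∀ i j : ℕ,
      (slEmbedding σ₂ (a ^ i * (b ^ j)⁻¹) : Matrix (Fin 3) (Fin 3) ℂ).trace =
        (slEmbedding σ₁ (a ^ i * (b ^ j)⁻¹) : Matrix (Fin 3) (Fin 3) ℂ).trace) :
    Complex.normSq (hform (J.map σ₁) u v) ≤ 1 := by
  -- Powers of `m` and `n`, weighted by the coefficients of `p` and `-q`, sum to the difference of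
  -- the projections at `σ₁`. At `σ₂` the same complex weights are used, and only positivity is
  -- needed.
  let w : Fin (p.natDegree + 1) ⊕ Fin (q.natDegree + 1) → Matrix.SpecialLinearGroup (Fin 3) (𝓞 F) :=
    Sum.elim (fun i => m ^ (i : ℕ)) (fun i => n ^ (i : ℕ))
  let c : Fin (p.natDegree + 1) ⊕ Fin (q.natDegree + 1) → ℂ :=
    Sum.elim (fun i => p.coeff i) (fun i => -q.coeff i)
  have hw (σ : F →+* ℂ) (i) : slEmbedding σ (w i) ∈ specialUnitary (J.map σ) := by
    rcases i with i | i
    · simpa [w] using pow_mem (slEmbedding_mem_specialUnitary hm σ) _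
    · simpa [w] using pow_mem (slEmbedding_mem_specialUnitary hn σ) _
  have hsum : ∑ i, c i • (slEmbedding σ₁ (w i) : Matrix (Fin 3) (Fin 3) ℂ) =
      proj (J.map σ₁) u - proj (J.map σ₁) v := by
    rw [Fintype.sum_sum_type, ← hp, ← hq, aeval_eq_sum_range, aeval_eq_sum_range,
      ← Fin.sum_univ_eq_sum_range (fun i => p.coeff i • _),
      ← Fin.sum_univ_eq_sum_range (fun i => q.coeff i • _), sub_eq_add_neg,
      ← Finset.sum_neg_distrib]
    simp [c, w]
  have hdet := hJ.signature.isUnit_det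
  have e1 := sum_trace_mul_inv hdet (hw σ₁) c
  rw [hsum, trace_proj_sub_proj_sq hJ.signature.isHermitian hdet hu hv] at e1
  have e2 := sum_trace_mul_inv_nonneg (hJ.posDef_or_neg h₂ h₂') (hw σ₂) c
  have e3 (i j) : ((slEmbedding σ₂ (w i) * (slEmbedding σ₂ (w j))⁻¹ :
      Matrix.SpecialLinearGroup (Fin 3) ℂ) : Matrix (Fin 3) (Fin 3) ℂ).trace =
      ((slEmbedding σ₁ (w i) * (slEmbedding σ₁ (w j))⁻¹ :
      Matrix.SpecialLinearGroup (Fin 3) ℂ) : Matrix (Fin 3) (Fin 3) ℂ).trace := by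
    rw [← map_inv, ← map_inv, ← map_mul, ← map_mul]
    rcases i with i | i <;> rcases j with j | j <;> exact htr _ (by simp) _ (by simp) _ _
  simp only [e3] at e2
  rw [e1, Complex.zero_le_real] at e2
  linarith

end Lattice

/-- The threshold is `(2 C²)²` with `C = 4 cosh² (R / 2) - 1`, the trace bound for two points at
distance at most `R`. -/
theorem lt_bergmanDist_of_lt_discr (K : Type u) {F : Type v} [Field K] [NumberField K] [Field F]
    [NumberField F] [Algebra K F] [Algebra.IsQuadraticExtension ℚ K] [IsTotallyReal K]
    [Algebra.IsQuadraticExtension K F] [IsCMField F] (hF : NoSmallNonrealInteger F) {R : ℝ}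
    (hD : (2 * (4 * Real.cosh (R / 2) ^ 2 - 1) ^ 2) ^ 2 < (discr K : ℝ)) {σ₁ : F →+* ℂ}
    {J : Matrix (Fin 3) (Fin 3) F} (hJ : IsAdmissibleForm σ₁ J) {x y : ℙ ℂ (Fin 3 → ℂ)}
    (hx : IsIsolatedEllipticPoint (J.map σ₁) (arithmeticLattice σ₁ J) x)
    (hy : IsIsolatedEllipticPoint (J.map σ₁) (arithmeticLattice σ₁ J) y) (hxy : x ≠ y) :
    R < bergmanDist (J.map σ₁) x y := by
  by_contra! hR
  have hsig := hJ.signature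
  have hH := hsig.isHermitian
  obtain ⟨u, hu, m, p, rfl, hm, hmu, hp⟩ := hx.exists_aeval_eq_proj hsig
  obtain ⟨v, hv, n, q, rfl, hn, hnv, hq⟩ := hy.exists_aeval_eq_proj hsig
  have hlt := one_lt_normSq_hform hsig hu hv hxy
  have htance := tance_mk_of_hform_eq hH hu hv
  have hτ : Complex.normSq (hform (J.map σ₁) u v) ≤ Real.cosh (R / 2) ^ 2 := by
    rw [← htance, ← cosh_sq_bergmanDist _ _ _ (htance ▸ hlt.le)]
    have h0 : 0 ≤ bergmanDist (J.map σ₁) (Projectivization.mk ℂ u (ne_zero_of_hform_eq hu))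
        (Projectivization.mk ℂ v (ne_zero_of_hform_eq hv)) :=
      mul_nonneg zero_le_two (Real.arcosh_nonneg (Real.one_le_sqrt.2 (htance ▸ hlt.le)))
    have : Real.cosh (bergmanDist (J.map σ₁) (Projectivization.mk ℂ u (ne_zero_of_hform_eq hu))
        (Projectivization.mk ℂ v (ne_zero_of_hform_eq hv)) / 2) ≤ Real.cosh (R / 2) := by
      rw [Real.cosh_le_cosh, abs_of_nonneg (by linarith), abs_of_nonneg (by linarith)]
      linarith
    gcongr
  set T := Real.cosh (R / 2) ^ 2 with hT
  have htrace {a b : Matrix.SpecialLinearGroup (Fin 3) (𝓞 F)} {u' v' : Fin 3 → ℂ}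
      (ha : slEmbedding σ₁ a ∈ specialUnitary (J.map σ₁))
      (hb : slEmbedding σ₁ b ∈ specialUnitary (J.map σ₁))
      (hu' : hform (J.map σ₁) u' u' = -1) (hv' : hform (J.map σ₁) v' v' = -1)
      (hau : slEmbedding σ₁ a • Projectivization.mk ℂ u' (ne_zero_of_hform_eq hu') =
        Projectivization.mk ℂ u' (ne_zero_of_hform_eq hu'))
      (hbv : slEmbedding σ₁ b • Projectivization.mk ℂ v' (ne_zero_of_hform_eq hv') =
        Projectivization.mk ℂ v' (ne_zero_of_hform_eq hv'))
      (hle : Complex.normSq (hform (J.map σ₁) u' v') ≤ T) (φ : F →+* ℂ) (i j : ℕ) :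
      (slEmbedding φ (a ^ i * (b ^ j)⁻¹) : Matrix (Fin 3) (Fin 3) ℂ).trace =
        (slEmbedding σ₁ (a ^ i * (b ^ j)⁻¹) : Matrix (Fin 3) (Fin 3) ℂ).trace := by
    have hai : slEmbedding σ₁ (a ^ i) ∈ specialUnitary (J.map σ₁) := by
      rw [map_pow]; exact pow_mem ha i
    have hbj : slEmbedding σ₁ (b ^ j)⁻¹ ∈ specialUnitary (J.map σ₁) := by
      rw [map_inv, map_pow]; exact inv_mem (pow_mem hb j)
    have hmem : slEmbedding σ₁ (a ^ i * (b ^ j)⁻¹) ∈ specialUnitary (J.map σ₁) := by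
      rw [map_mul]; exact mul_mem hai hbj
    rw [trace_slEmbedding, trace_slEmbedding]
    -- `C ≥ 3` holds because `T` is at least the tance, which exceeds 1.
    refine hF.embedding_eq K (C := 4 * T - 1) (by linarith) hD ?_ (fun ψ h1 h2 => ?_) φ
    · rw [← trace_slEmbedding, map_mul]
      refine (norm_trace_mul_le_of_fix hsig hai hbj hu' hv' ?_ ?_).trans (by linarith)
      · rw [map_pow]
        exact pow_mem (show _ ∈ MulAction.stabilizer _ _ from hau) i
      · rw [map_inv, map_pow]
        exact inv_mem (pow_mem (show _ ∈ MulAction.stabilizer _ _ from hbv) j)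
    · rw [← trace_slEmbedding]
      exact norm_trace_le_three (hJ.posDef_or_neg h1 h2) (slEmbedding_mem_specialUnitary hmem ψ)
  obtain ⟨σ₂, h₂, h₂'⟩ := exists_embedding_ne K σ₁
  -- Covers the Gram entries in which both factors fix the same point.
  have hself {z : Fin 3 → ℂ} (hz : hform (J.map σ₁) z z = -1) :
      Complex.normSq (hform (J.map σ₁) z z) ≤ T := by
    rw [hz]; simp; linarith
  have hτ' : Complex.normSq (hform (J.map σ₁) v u) ≤ T := by
    rw [← star_hform hH, RCLike.star_def, Complex.normSq_conj]; exact hτ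
  refine absurd hlt (not_lt.2 (normSq_hform_le_one_of_trace_eq hJ h₂ h₂' hu hv hm hn hp hq ?_))
  rintro a (rfl | rfl) b (rfl | rfl) i j
  · exact htrace hm hm hu hu hmu hmu (hself hu) σ₂ i j
  · exact htrace hm hn hu hv hmu hnv hτ σ₂ i j
  · exact htrace hn hm hv hu hnv hmu hτ' σ₂ i j
  · exact htrace hn hn hv hv hnv hnv (hself hv) σ₂ i j

end Proof

end BallQuotient

theorem mainTheorem3 :
    (∃ D₀' : ℝ, 0 < D₀' ∧
      ∀ (K : Type u) (F : Type v) [Field K] [NumberField K] [Field F] [NumberField F]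
        [Algebra K F] [Algebra.IsQuadraticExtension ℚ K] [IsTotallyReal K]
        [Algebra.IsQuadraticExtension K F] [IsCMField F],
        D₀' < (Ideal.absNorm (BallQuotient.relDiscr K F) : ℝ) →
          BallQuotient.NoSmallNonrealInteger F) ∧
    ∀ R : ℝ, 0 < R → ∃ D₀ : ℝ, 0 < D₀ ∧
      ∀ (K : Type u) (F : Type v) [Field K] [NumberField K] [Field F] [NumberField F]
        [Algebra K F] [Algebra.IsQuadraticExtension ℚ K] [IsTotallyReal K]
        [Algebra.IsQuadraticExtension K F] [IsCMField F],
        BallQuotient.NoSmallNonrealInteger F →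
        D₀ < (discr K : ℝ) →
        ∀ (σ₁ : F →+* ℂ) (J : Matrix (Fin 3) (Fin 3) F),
          BallQuotient.IsAdmissibleForm σ₁ J →
          ∀ x y : ℙ ℂ (Fin 3 → ℂ),
            BallQuotient.IsIsolatedEllipticPoint (J.map σ₁)
              (BallQuotient.arithmeticLattice σ₁ J) x →
            BallQuotient.IsIsolatedEllipticPoint (J.map σ₁)
              (BallQuotient.arithmeticLattice σ₁ J) y →
            x ≠ y →
            R < BallQuotient.bergmanDist (J.map σ₁) x y := by
  refine ⟨⟨1296, by norm_num, ?_⟩, fun R _ => ?_⟩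
  · intro K F _ _ _ _ _ _ _ _ _ hD
    by_contra h
    have := BallQuotient.absNorm_relDiscr_le K h
    have : (Ideal.absNorm (BallQuotient.relDiscr K F) : ℝ) ≤ 1296 := by exact_mod_cast this
    linarith
  · have hC := Real.one_le_cosh (R / 2)
    refine ⟨(2 * (4 * Real.cosh (R / 2) ^ 2 - 1) ^ 2) ^ 2, ?_, ?_⟩
    · have : 0 < 4 * Real.cosh (R / 2) ^ 2 - 1 := by nlinarith
      positivity
    · intro K F _ _ _ _ _ _ _ _ _ hF hD σ₁ J hJ x y hx hy hxy
      exact BallQuotient.lt_bergmanDist_of_lt_discr K hF hD hJ hx hy hxy
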